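/- Let $M>1$, $K_I,K_E\ge 0$ be integers, $P>0$, $0<\zeta\le 1$, $\sigma_i>0$, $\gamma_i>0$ ($1\le i\le K_I$), and $\alpha_j\ge 0$ ($1\le j\le K_E$), not all $\alpha_j$ zero. Let the channel vectors $h_1,\dots,h_{K_I},g_1,\dots,g_{K_E}\in\mathbb C^{1\times M}$ be mutually independent random row vectors, each having a probability density with respect to Lebesgue measure on $\mathbb C^{M}$. Put $G=\zeta\sum_j\alpha_j g_j^Hg_j$. (P1) is the problem of maximizing $\sum_i w_i^HGw_i+\sum_j v_j^HGv_j$ over $w_i,v_j\in\mathbb C^{M}$ subject to $$\frac{|h_iw_i|^2}{\sum_{k\ne i}|h_iw_k|^2+\sum_j|h_iv_j|^2+\sigma_i^2}\ge\gamma_i\quad(\forall i),\qquad \sum_i\|w_i\|^2+\sum_j\|v_j\|^2\le P .$$ Its semidefinite relaxation (SDR1) is the problem of maximizing $\sum_i\operatorname{tr}(GW_i)+\operatorname{tr}(GW_E)$ over $M\times M$ matrices $W_i\succeq0$, $W_E\succeq 0$ subject to $$\frac{\operatorname{tr}(h_i^Hh_iW_i)}{\gamma_i}-\sum_{k\ne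 i}\operatorname{tr}(h_i^Hh_iW_k)-\operatorname{tr}(h_i^Hh_iW_E)-\sigma_i^2\ge 0\quad(\forall i),\qquad \sum_i\operatorname{tr}(W_i)+\operatorname{tr}(W_E)\le P .$$ Call a channel realization OeBF-feasible if for some unit eigenvector $v_E$ of $G$ for its largest eigenvalue there are $p_i\ge 0$ with $\sum_ip_i\le P$ and $\dfrac{p_i|h_iv_E|^2}{\sum_{k\neq i}p_k|h_iv_E|^2+\sigma_i^2}\ge\gamma_i$ for all $i$. Then, with probability one, the following holds: if (SDR1) is feasible and the realization is not OeBF-feasible, then (SDR1) has an optimal solution, and every optimal solution $(\{W_i^\star\},W_E^\star)$ satisfies $\operatorname{rank}(W_i^\star)=1$ for all $i$ and $W_E^\star=0$. Consequently the relaxation is tight and no energy beam is needed: there are $w_i$ with $W_i^\star=w_iw_i^H$ such that $(\{w_i\},\{v_j=0\})$ is an optimal solution of (P1), with the same objective value as $(\{W_i^\star\},W_E^\star)$ in (SDR1). -/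

import Mathlib

open MeasureTheory ProbabilityTheory Matrix
open scoped ComplexOrder

noncomputable section

namespace SWIPT

/-- The deterministic data of the downlink with `KI` information-decoding (ID) receivers and
`KE` energy-harvesting (EH) receivers. -/
structure Params (KI KE : ℕ) where
  /-- transmit sum-power budget -/
  P : ℝ
  /-- energy harvesting efficiency -/
  ζ : ℝ
  /-- standard deviation of the noise at each ID receiver (the noise power is `σ i ^ 2`) -/
  σ : Fin KI → ℝ
  /-- SINR target of each ID receiver -/
  γ : Fin KI → ℝ
  /-- energy weight of each EH receiver -/
  α : Fin KE → ℝ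

variable {M KI KE : ℕ}

/-- Squared Euclidean norm of a complex vector. -/
def sqNorm (w : Fin M → ℂ) : ℝ := ∑ m, ‖w m‖ ^ 2

/-- The `M × M` matrix `hᴴ h` of a row vector `h`. -/
def gram (h : Fin M → ℂ) : Matrix (Fin M) (Fin M) ℂ := vecMulVec (star h) h

/-- The matrix `w wᴴ` of a column vector `w`. -/
def outer (w : Fin M → ℂ) : Matrix (Fin M) (Fin M) ℂ := vecMulVec w (star w)

/-- `G = ζ ∑ⱼ αⱼ gⱼᴴ gⱼ`. -/
def energyMatrix (p : Params KI KE) (g : Fin KE → Fin M → ℂ) : Matrix (Fin M) (Fin M) ℂ :=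
  (p.ζ : ℂ) • ∑ j, (p.α j : ℂ) • gram (g j)

/-! ### The beamforming problem (P1)

A point is a pair of families: information beams `w i` and energy beams `v j`. -/

/-- SINR of the `i`-th ID receiver when the energy signals are not cancelled (Type I). -/
def sinrI (p : Params KI KE) (h : Fin KI → Fin M → ℂ)
    (x : (Fin KI → Fin M → ℂ) × (Fin KE → Fin M → ℂ)) (i : Fin KI) : ℝ :=
  ‖h i ⬝ᵥ x.1 i‖ ^ 2 /
    (∑ k ∈ Finset.univ.erase i, ‖h i ⬝ᵥ x.1 k‖ ^ 2 + ∑ j, ‖h i ⬝ᵥ x.2 j‖ ^ 2 + p.σ i ^ 2)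

/-- Feasible set of (P1). -/
def p1Feasible (p : Params KI KE) (h : Fin KI → Fin M → ℂ) :
    Set ((Fin KI → Fin M → ℂ) × (Fin KE → Fin M → ℂ)) :=
  {x | (∀ i, p.γ i ≤ sinrI p h x i) ∧ ∑ i, sqNorm (x.1 i) + ∑ j, sqNorm (x.2 j) ≤ p.P}

/-- Objective of (P1): the weighted sum of the harvested powers. -/
def p1Objective (p : Params KI KE) (g : Fin KE → Fin M → ℂ)
    (x : (Fin KI → Fin M → ℂ) × (Fin KE → Fin M → ℂ)) : ℝ :=
  ∑ i, (star (x.1 i) ⬝ᵥ energyMatrix p g *ᵥ x.1 i).re +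
    ∑ j, (star (x.2 j) ⬝ᵥ energyMatrix p g *ᵥ x.2 j).re

/-- Global optimality for (P1). -/
def IsP1Optimal (p : Params KI KE) (h : Fin KI → Fin M → ℂ) (g : Fin KE → Fin M → ℂ)
    (x : (Fin KI → Fin M → ℂ) × (Fin KE → Fin M → ℂ)) : Prop :=
  x ∈ p1Feasible p h ∧ IsMaxOn (p1Objective p g) (p1Feasible p h) x

/-! ### The semidefinite relaxation (SDR1)

A point is a family `W i` together with one matrix `W_E`. All traces that occur are real at
feasible points, so taking real parts loses nothing. -/

/-- Feasible set of (SDR1). -/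
def sdr1Feasible (p : Params KI KE) (h : Fin KI → Fin M → ℂ) :
    Set ((Fin KI → Matrix (Fin M) (Fin M) ℂ) × Matrix (Fin M) (Fin M) ℂ) :=
  {X | (∀ i, 0 ≤ (gram (h i) * X.1 i).trace.re / p.γ i
          - ∑ k ∈ Finset.univ.erase i, (gram (h i) * X.1 k).trace.re
          - (gram (h i) * X.2).trace.re - p.σ i ^ 2) ∧
        ∑ i, (X.1 i).trace.re + X.2.trace.re ≤ p.P ∧
        (∀ i, (X.1 i).PosSemidef) ∧ X.2.PosSemidef}

/-- Objective of (SDR1). -/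
def sdr1Objective (p : Params KI KE) (g : Fin KE → Fin M → ℂ)
    (X : (Fin KI → Matrix (Fin M) (Fin M) ℂ) × Matrix (Fin M) (Fin M) ℂ) : ℝ :=
  ∑ i, (energyMatrix p g * X.1 i).trace.re + (energyMatrix p g * X.2).trace.re

/-- Optimality for (SDR1). -/
def IsSDR1Optimal (p : Params KI KE) (h : Fin KI → Fin M → ℂ) (g : Fin KE → Fin M → ℂ)
    (X : (Fin KI → Matrix (Fin M) (Fin M) ℂ) × Matrix (Fin M) (Fin M) ℂ) : Prop :=
  X ∈ sdr1Feasible p h ∧ IsMaxOn (sdr1Objective p g) (sdr1Feasible p h) X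

/-! ### The degenerate case: all information beams along the optimal energy beamformer -/

/-- `v` is a unit eigenvector of `G` for its largest eigenvalue. -/
def IsDominantEigenvector (G : Matrix (Fin M) (Fin M) ℂ) (v : Fin M → ℂ) : Prop :=
  sqNorm v = 1 ∧ ∃ ξ : ℝ, G *ᵥ v = (ξ : ℂ) • v ∧
    ∀ μ : ℝ, Module.End.HasEigenvalue (Matrix.toLin' G) (μ : ℂ) → μ ≤ ξ

/-- Aligning all information beams with a dominant eigenvector `v` of `G`, that is
`w i = √(q i) • v` with suitable powers `q i`, meets all SINR targets within the budget. -/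
def OeBFFeasible (p : Params KI KE) (h : Fin KI → Fin M → ℂ) (g : Fin KE → Fin M → ℂ) : Prop :=
  ∃ v : Fin M → ℂ, IsDominantEigenvector (energyMatrix p g) v ∧
    ∃ q : Fin KI → ℝ, (∀ i, 0 ≤ q i) ∧
      (∀ i, p.γ i ≤ q i * ‖h i ⬝ᵥ v‖ ^ 2 /
        (∑ k ∈ Finset.univ.erase i, q k * ‖h i ⬝ᵥ v‖ ^ 2 + p.σ i ^ 2)) ∧
      ∑ i, q i ≤ p.P

/-! ### Random channels -/

/-- All channel vectors are mutually independent, and each has a continuous distribution on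
`ℂ^M`, i.e. a probability density with respect to Lebesgue measure. (Almost sure linear
independence of any at most `M` channel vectors, and distinctness of the singular values of the
matrix they form, are consequences.) -/
structure IndependentChannels {Ω : Type*} [MeasurableSpace Ω] (μ : Measure Ω)
    (h : Fin KI → Ω → Fin M → ℂ) (g : Fin KE → Ω → Fin M → ℂ) : Prop where
  measurable_h : ∀ i, Measurable (h i)
  measurable_g : ∀ j, Measurable (g j)
  indep : iIndepFun (Sum.elim h g) μ
  density_h : ∀ i, HasPDF (h i) μ volume
  density_g : ∀ j, HasPDF (g j) μ volume

end SWIPT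

end

/-!
Fritz John multipliers `c` of the objective, `β` of the power budget and `l i` of the SINR
constraints exist at every optimal point of (SDR1). The slack of `W_E` is the positive semidefinite
matrix `E = β I + ∑ l k • hₖᴴhₖ - c • G`, and that of `W i` is `E - l i (1 + 1 / γ i) • hᵢᴴhᵢ`. A
vector `x` of `ker E` is annihilated by every `h i` with `l i ≠ 0`, and satisfies `c • G x = β • x`,
where `β > 0`.

Almost surely the nonzero eigenvalues of `G` are simple and no `h i` annihilates an eigenvector of
`G` for one of them. To see this, add one channel at a time: the channels that annihilate such an
eigenvector lie in finitely many hyperplanes, and adding the rank-one matrix of any other channel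
keeps the nonzero spectrum simple.

Hence `E` is nonsingular unless `l = 0`, in which case `ker E` is spanned by a dominant eigenvector
of `G` and all beams align with it, making the realization OeBF-feasible. If `E` is nonsingular,
complementary slackness gives `W_E = 0` and `W i = l i (1 + 1 / γ i) • E⁻¹ hᵢᴴhᵢ W i`, which has
rank one.
-/

namespace SWIPT

/-! ### Simple nonzero spectrum -/

section Spectrum

variable {n K : Type*} [Fintype n] [Field K]

/-- The eigenspaces of `A` for its nonzero eigenvalues are one-dimensional. -/
def SimpleNonzeroSpectrum (A : Matrix n n K) : Prop :=
  ∀ β : K, β ≠ 0 → ∀ x y : n → K, x ≠ 0 → A *ᵥ x = β • x → A *ᵥ y = β • y → ∃ c : K, y = c • x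

/-- The row vector `h` annihilates an eigenvector of `A` for a nonzero eigenvalue. -/
def AnnihilatesEigenvector (A : Matrix n n K) (h : n → K) : Prop :=
  ∃ β : K, β ≠ 0 ∧ ∃ x : n → K, x ≠ 0 ∧ A *ᵥ x = β • x ∧ h ⬝ᵥ x = 0

lemma simpleNonzeroSpectrum_zero : SimpleNonzeroSpectrum (0 : Matrix n n K) := by
  intro β hβ x _ hx hβx _
  rw [zero_mulVec, eq_comm, smul_eq_zero] at hβx
  exact absurd hβx (not_or_intro hβ hx)

lemma simpleNonzeroSpectrum_add_vecMulVec {A : Matrix n n K} {h : n → K}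
    (hA : ¬ AnnihilatesEigenvector A h) (u : n → K) :
    SimpleNonzeroSpectrum (A + vecMulVec u h) := by
  intro β hβ x y hx hβx hβy
  have eq_zero_of_dotProduct_eq_zero : ∀ z : n → K,
      (A + vecMulVec u h) *ᵥ z = β • z → h ⬝ᵥ z = 0 → z = 0 := by
    intro z hz hhz
    by_contra hz0
    refine hA ⟨β, hβ, z, hz0, ?_, hhz⟩
    simpa [add_mulVec, vecMulVec_mulVec, hhz] using hz
  have hhx : h ⬝ᵥ x ≠ 0 := fun h0 => hx (eq_zero_of_dotProduct_eq_zero x hβx h0)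
  refine ⟨h ⬝ᵥ y / h ⬝ᵥ x, sub_eq_zero.1 (eq_zero_of_dotProduct_eq_zero _ ?_ ?_)⟩
  · rw [mulVec_sub, mulVec_smul, hβx, hβy, smul_sub, smul_comm]
  · rw [dotProduct_sub, dotProduct_smul, smul_eq_mul, div_mul_cancel₀ _ hhx, sub_self]

end Spectrum

section NullSets

variable {n : Type*} [Fintype n]

lemma volume_setOf_dotProduct_eq_zero {x : n → ℂ} (hx : x ≠ 0) :
    volume {h : n → ℂ | h ⬝ᵥ x = 0} = 0 := by
  refine Measure.addHaar_submodule volume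
    (LinearMap.ker ((dotProductBilin ℝ ℂ).flip x : (n → ℂ) →ₗ[ℝ] ℂ)) fun htop => hx ?_
  have hstar : star x ∈ LinearMap.ker ((dotProductBilin ℝ ℂ).flip x : (n → ℂ) →ₗ[ℝ] ℂ) :=
    htop ▸ Submodule.mem_top
  exact dotProduct_star_self_eq_zero.1 hstar

lemma volume_setOf_annihilatesEigenvector {A : Matrix n n ℂ} (hA : SimpleNonzeroSpectrum A) :
    volume {h | AnnihilatesEigenvector A h} = 0 := by
  have hfin : {β | Module.End.HasEigenvalue A.mulVecLin β}.Finite :=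
    Module.End.finite_hasEigenvalue _
  choose! y hy using fun β (hβ : Module.End.HasEigenvalue A.mulVecLin β) =>
    hβ.exists_hasEigenvector
  have hcover : {h | AnnihilatesEigenvector A h} ⊆
      ⋃ β ∈ {β | Module.End.HasEigenvalue A.mulVecLin β}, {h | h ⬝ᵥ y β = 0} := by
    rintro h ⟨β, hβ, x, hx, hβx, hhx⟩
    have hβev : Module.End.HasEigenvalue A.mulVecLin β :=
      Module.End.hasEigenvalue_of_hasEigenvector ⟨Module.End.mem_eigenspace_iff.2 hβx, hx⟩
    obtain ⟨c, hc⟩ := hA β hβ x (y β) hx hβx (hy β hβev).apply_eq_smul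
    exact Set.mem_biUnion hβev (by simp [hc, hhx])
  refine measure_mono_null hcover ((measure_biUnion_null_iff hfin.countable).2 fun β hβ => ?_)
  exact volume_setOf_dotProduct_eq_zero (hy β hβ).2

lemma measurableSet_image_snd_of_isClosed {X Y : Type*} [TopologicalSpace X]
    [SigmaCompactSpace X] [TopologicalSpace Y] [MeasurableSpace Y] [OpensMeasurableSpace Y]
    {S : Set (X × Y)} (hS : IsClosed S) : MeasurableSet (Prod.snd '' S) := by
  have hcover : Prod.snd '' S =
      ⋃ k, Prod.snd '' {t : compactCovering X k × Y | (↑t.1, t.2) ∈ S} := by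
    ext y
    simp only [Set.mem_image, Prod.exists, exists_eq_right, Set.mem_iUnion, Set.mem_ofPred_eq]
    exact ⟨fun ⟨x, hx⟩ => (exists_mem_compactCovering x).imp fun k hk => ⟨⟨x, hk⟩, hx⟩,
      fun ⟨_, x, hx⟩ => ⟨x, hx⟩⟩
  rw [hcover]
  refine MeasurableSet.iUnion fun k => IsClosed.measurableSet ?_
  have : CompactSpace (compactCovering X k) :=
    isCompact_iff_compactSpace.1 (isCompact_compactCovering X k)
  exact isClosedMap_snd_of_compactSpace _ (hS.preimage (by fun_prop))

lemma measurableSet_setOf_annihilatesEigenvector {E : Type*} [TopologicalSpace E]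
    [SecondCountableTopology E] [MeasurableSpace E] [OpensMeasurableSpace E]
    {A : E → Matrix n n ℂ} (hA : Continuous A) :
    MeasurableSet {q : E × (n → ℂ) | AnnihilatesEigenvector (A q.1) q.2} := by
  let T : Set (ℂ × (n → ℂ)) := {t | t.1 ≠ 0 ∧ t.2 ≠ 0}
  have hT : IsOpen T :=
    (isOpen_ne_fun continuous_fst continuous_const).inter
      (isOpen_ne_fun continuous_snd continuous_const)
  have : LocallyCompactSpace T := hT.locallyCompactSpace
  have hclosed : IsClosed {z : T × (E × (n → ℂ)) |
      A z.2.1 *ᵥ z.1.1.2 = z.1.1.1 • z.1.1.2 ∧ z.2.2 ⬝ᵥ z.1.1.2 = 0} := by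
    refine (isClosed_eq ?_ (by fun_prop)).inter (isClosed_eq ?_ continuous_const)
    · exact (hA.comp (by fun_prop)).matrix_mulVec (by fun_prop)
    · exact Continuous.dotProduct (by fun_prop) (by fun_prop)
  convert measurableSet_image_snd_of_isClosed hclosed using 1
  ext q
  constructor
  · rintro ⟨β, hβ, x, hx, hβx, hhx⟩
    exact ⟨(⟨(β, x), hβ, hx⟩, q), ⟨hβx, hhx⟩, rfl⟩
  · rintro ⟨⟨⟨⟨β, x⟩, hβ, hx⟩, _⟩, ⟨hβx, hhx⟩, rfl⟩
    exact ⟨β, hβ, x, hx, hβx, hhx⟩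

end NullSets

/-! ### Genericity of independent channels -/

lemma ae_notMem_of_indepFun {Ω E F : Type*} [MeasurableSpace Ω] [MeasurableSpace E]
    [MeasurableSpace F] {μ : Measure Ω} [IsFiniteMeasure μ] {ν : Measure F}
    {X : Ω → E} {Y : Ω → F} (hX : Measurable X) (hY : Measurable Y) (hXY : IndepFun X Y μ)
    (hν : μ.map Y ≪ ν) {B : Set (E × F)} (hB : MeasurableSet B)
    (hnull : ∀ᵐ ω ∂μ, ν {y | (X ω, y) ∈ B} = 0) : ∀ᵐ ω ∂μ, (X ω, Y ω) ∉ B := by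
  have hmap : ∀ᵐ z ∂μ.map fun ω => (X ω, Y ω), z ∉ B := by
    refine measure_eq_zero_iff_ae_notMem.1 ?_
    rw [(indepFun_iff_map_prod_eq_prod_map_map hX.aemeasurable hY.aemeasurable).1 hXY,
      Measure.measure_prod_null hB]
    refine (ae_map_iff hX.aemeasurable
      (measurable_measure_prodMk_left hB (measurableSet_singleton 0))).2 ?_
    filter_upwards [hnull] with ω hω using hν hω
  exact ae_of_ae_map (hX.prodMk hY).aemeasurable hmap

section RandomVectors

variable {Ω ι n : Type*} [Fintype n] [MeasurableSpace Ω] {μ : Measure Ω} [IsFiniteMeasure μ]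
  {f : ι → Ω → n → ℂ}

lemma ae_not_annihilatesEigenvector (hf : ∀ i, Measurable (f i)) (hind : iIndepFun f μ)
    {i : ι} (hac : μ.map (f i) ≪ volume) (c : ι → ℂ) {s : Finset ι} (hi : i ∉ s)
    (hs : ∀ᵐ ω ∂μ,
      SimpleNonzeroSpectrum (∑ j ∈ s, c j • vecMulVec (star (f j ω)) (f j ω))) :
    ∀ᵐ ω ∂μ,
      ¬ AnnihilatesEigenvector (∑ j ∈ s, c j • vecMulVec (star (f j ω)) (f j ω)) (f i ω) := by
  let A : (s → n → ℂ) → Matrix n n ℂ := fun e => ∑ j : s, c j • vecMulVec (star (e j)) (e j)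
  have hA : Continuous A := by
    refine continuous_finsetSum _ fun j _ => Continuous.const_smul ?_ (c j)
    exact Continuous.matrix_vecMulVec (by fun_prop) (by fun_prop)
  have hAf : ∀ ω, A (fun j => f j ω) = ∑ j ∈ s, c j • vecMulVec (star (f j ω)) (f j ω) :=
    fun ω => Finset.sum_coe_sort s fun j => c j • vecMulVec (star (f j ω)) (f j ω)
  have hindep : IndepFun (fun ω (j : s) => f j ω) (f i) μ :=
    (hind.indepFun_finset s {i} (Finset.disjoint_singleton_right.2 hi) hf).comp
      measurable_id
      (measurable_pi_apply (⟨i, Finset.mem_singleton_self i⟩ : ({i} : Finset ι)))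
  simp only [← hAf] at hs ⊢
  exact ae_notMem_of_indepFun (measurable_pi_lambda _ fun j : s => hf j) (hf i) hindep hac
    (measurableSet_setOf_annihilatesEigenvector hA)
    (hs.mono fun _ => volume_setOf_annihilatesEigenvector)

lemma ae_simpleNonzeroSpectrum (hf : ∀ i, Measurable (f i)) (hind : iIndepFun f μ)
    (hac : ∀ i, μ.map (f i) ≪ volume) (c : ι → ℂ) (s : Finset ι) :
    ∀ᵐ ω ∂μ, SimpleNonzeroSpectrum (∑ j ∈ s, c j • vecMulVec (star (f j ω)) (f j ω)) := by
  classical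
  induction s using Finset.induction_on with
  | empty => simp only [Finset.sum_empty, simpleNonzeroSpectrum_zero, Filter.eventually_true]
  | insert i s hi ih =>
    filter_upwards [ae_not_annihilatesEigenvector hf hind (hac i) c hi ih] with ω hω
    rw [Finset.sum_insert hi, add_comm, ← smul_vecMulVec]
    exact simpleNonzeroSpectrum_add_vecMulVec hω _

end RandomVectors

/-- General position of a matrix `G` and a family of row vectors `h`. It holds almost surely for
the energy matrix and the information channels, and is all that is needed of the channel
distribution. -/
structure IsGeneric {ι n : Type*} [Fintype n] (G : Matrix n n ℂ) (h : ι → n → ℂ) : Prop where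
  ne_zero : G ≠ 0
  simple : SimpleNonzeroSpectrum G
  not_annihilatesEigenvector : ∀ i, ¬ AnnihilatesEigenvector G (h i)

variable {M KI KE : ℕ} {p : Params KI KE}

lemma trace_energyMatrix_pos {g : Fin KE → Fin M → ℂ} (hζ : 0 < p.ζ) (hα : ∀ j, 0 ≤ p.α j)
    (hα' : ∃ j, 0 < p.α j) (hg : ∀ j, g j ≠ 0) : 0 < (energyMatrix p g).trace := by
  obtain ⟨j, hj⟩ := hα'
  have hgram : ∀ k, 0 < (gram (g k)).trace := fun k => by
    rw [gram, trace_vecMulVec]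
    exact dotProduct_star_self_pos_iff.2 (hg k)
  simp only [energyMatrix, trace_smul, trace_sum, smul_eq_mul]
  refine mul_pos (by exact_mod_cast hζ) (Finset.sum_pos' (fun k _ => ?_) ⟨j, Finset.mem_univ j, ?_⟩)
  · exact mul_nonneg (by exact_mod_cast hα k) (hgram k).le
  · exact mul_pos (by exact_mod_cast hj) (hgram j)

lemma ae_isGeneric [NeZero M] (hζ : 0 < p.ζ) (hα : ∀ j, 0 ≤ p.α j) (hα' : ∃ j, 0 < p.α j)
    {Ω : Type*} [MeasurableSpace Ω] {μ : Measure Ω} [IsFiniteMeasure μ]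
    {h : Fin KI → Ω → Fin M → ℂ} {g : Fin KE → Ω → Fin M → ℂ}
    (hchan : IndependentChannels μ h g) :
    ∀ᵐ ω ∂μ, IsGeneric (energyMatrix p fun j => g j ω) fun i => h i ω := by
  have hmeas : ∀ k, Measurable (Sum.elim h g k) := Sum.rec hchan.measurable_h hchan.measurable_g
  have hac : ∀ k, μ.map (Sum.elim h g k) ≪ volume :=
    Sum.rec (fun i => (hchan.density_h i).absolutelyContinuous')
      fun j => (hchan.density_g j).absolutelyContinuous'
  let c : Fin KI ⊕ Fin KE → ℂ := Sum.elim 0 fun j => p.ζ * p.α j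
  let s : Finset (Fin KI ⊕ Fin KE) := Finset.univ.map Function.Embedding.inr
  have henergy : ∀ ω, energyMatrix p (fun j => g j ω) =
      ∑ k ∈ s, c k • vecMulVec (star (Sum.elim h g k ω)) (Sum.elim h g k ω) := fun ω => by
    simp [s, c, energyMatrix, gram, Finset.smul_sum, mul_smul]
  have hsimple := ae_simpleNonzeroSpectrum hmeas hchan.indep hac c s
  have hann : ∀ᵐ ω ∂μ, ∀ i, ¬ AnnihilatesEigenvector
      (∑ k ∈ s, c k • vecMulVec (star (Sum.elim h g k ω)) (Sum.elim h g k ω)) (h i ω) :=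
    ae_all_iff.2 fun i => ae_not_annihilatesEigenvector hmeas hchan.indep (i := Sum.inl i)
      (hac _) c (by simp [s]) hsimple
  have hg : ∀ᵐ ω ∂μ, ∀ j, g j ω ≠ 0 := ae_all_iff.2 fun j =>
    ae_of_ae_map (hchan.measurable_g j).aemeasurable
      ((hac (Sum.inr j)).ae_le (compl_mem_ae_iff.2 (measure_singleton 0)))
  filter_upwards [hsimple, hann, hg] with ω hsimple hann hg
  rw [← henergy] at hsimple hann
  refine ⟨fun h0 => ?_, hsimple, hann⟩
  simpa [h0] using trace_energyMatrix_pos hζ hα hα' hg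

/-! ### Multipliers of conic linear programs -/

section ConicPrograms

lemma nonpos_of_forall_pos_mul_le {a b : ℝ} (h : ∀ t > 0, t * a ≤ b) : a ≤ 0 := by
  by_contra! ha
  have := h ((|b| + 1) / a) (by positivity)
  rw [div_mul_cancel₀ _ ha.ne'] at this
  linarith [le_abs_self b]

lemma exists_nonneg_ne_zero_dotProduct_le {κ : Type*} [Fintype κ] {C : Set (κ → ℝ)}
    (hC : Convex ℝ C) (hne : C.Nonempty) {d : κ → ℝ} (hd : ∀ y ∈ C, ∃ k, y k ≤ d k) :
    ∃ m : κ → ℝ, 0 ≤ m ∧ m ≠ 0 ∧ ∀ y ∈ C, m ⬝ᵥ y ≤ m ⬝ᵥ d := by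
  classical
  let O : Set (κ → ℝ) := Set.univ.pi fun k => Set.Ioi (d k)
  have hO : IsOpen O := isOpen_set_pi Set.finite_univ fun _ _ => isOpen_Ioi
  have hOC : Disjoint O C := Set.disjoint_left.2 fun y hyO hyC =>
    let ⟨k, hk⟩ := hd y hyC
    (hyO k trivial).not_ge hk
  obtain ⟨f, u, hfO, hfC⟩ :=
    geometric_hahn_banach_open (convex_pi fun k _ => convex_Ioi (d k)) hO hC hOC
  obtain ⟨w, hw⟩ := (dotProductEquiv ℝ κ).surjective f
  replace hw : ∀ y, f y = w ⬝ᵥ y := fun y => (LinearMap.congr_fun hw y).symm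
  simp only [hw] at hfO hfC
  have hfO' : ∀ y, d ≤ y → w ⬝ᵥ y ≤ u := by
    have hclosure : closure O ⊆ {y | w ⬝ᵥ y ≤ u} :=
      closure_minimal (fun y hy => (hfO y hy).le) (isClosed_le (by fun_prop) continuous_const)
    intro y hy
    refine hclosure ?_
    simpa only [O, closure_pi_set, closure_Ioi, Set.mem_univ_pi, Set.mem_Ici, Pi.le_def]
      using hy
  have hw0 : ∀ k, w k ≤ 0 := fun k =>
    nonpos_of_forall_pos_mul_le (b := u - w ⬝ᵥ d) fun t ht => by
      have := hfO' (d + t • Pi.single k 1) (le_add_of_nonneg_right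
        (smul_nonneg ht.le (Pi.single_nonneg.2 zero_le_one)))
      simp only [dotProduct_add, dotProduct_smul, dotProduct_single_one, smul_eq_mul] at this
      linarith
  refine ⟨-w, fun k => neg_nonneg.2 (hw0 k), fun h0 => ?_, fun y hy => ?_⟩
  · obtain ⟨y, hy⟩ := hne
    have hlt := (hfO (d + 1) fun k _ => lt_add_one (d k)).trans_le (hfC y hy)
    simp [neg_eq_zero.1 h0] at hlt
  · simpa only [neg_dotProduct, neg_le_neg_iff] using (hfO' d le_rfl).trans (hfC y hy)

/-- Fritz John multipliers: no constraint qualification is assumed, so `c` may vanish. -/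
lemma exists_conic_multipliers {κ E : Type*} [Fintype κ] [AddCommGroup E] [Module ℝ E]
    {K : PointedCone ℝ E} {φ : E →ₗ[ℝ] ℝ} {a : κ → E →ₗ[ℝ] ℝ} {b : κ → ℝ} {x : E} (hx : x ∈ K)
    (hxb : ∀ k, a k x ≤ b k) (hmax : ∀ y ∈ K, (∀ k, a k y ≤ b k) → φ y ≤ φ x) :
    ∃ (c : ℝ) (m : κ → ℝ), 0 ≤ c ∧ 0 ≤ m ∧ (c ≠ 0 ∨ m ≠ 0) ∧ c * φ x = ∑ k, m k * b k ∧
      c * φ x = ∑ k, m k * a k x ∧ ∀ y ∈ K, c * φ y ≤ ∑ k, m k * a k y := by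
  let F : E →ₗ[ℝ] Option κ → ℝ := LinearMap.pi fun k => k.elim φ fun k => -a k
  obtain ⟨m, hm0, hm, hmF⟩ := exists_nonneg_ne_zero_dotProduct_le (C := F '' K)
    (d := fun k => k.elim (φ x) fun k => -b k) (K.convex.is_linear_image F.isLinear)
    ⟨_, x, hx, rfl⟩ (by
      rintro _ ⟨y, hy, rfl⟩
      by_contra! hlt
      have hyb : ∀ k, a k y ≤ b k := fun k => (neg_lt_neg_iff.1 (hlt (some k))).le
      exact (hlt none).not_ge (hmax y hy hyb))
  have hF : ∀ y, m ⬝ᵥ F y = m none * φ y - ∑ k, m (some k) * a k y := fun y => by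
    simp [dotProduct, F, Fintype.sum_option, sub_eq_add_neg]
  have hd : m ⬝ᵥ (fun k => k.elim (φ x) fun k => -b k : Option κ → ℝ) =
      m none * φ x - ∑ k, m (some k) * b k := by
    simp [dotProduct, Fintype.sum_option, sub_eq_add_neg]
  simp only [Set.forall_mem_image, hd] at hmF
  have hcone : ∀ y ∈ K, m ⬝ᵥ F y ≤ 0 := fun y hy => nonpos_of_forall_pos_mul_le fun t ht => by
    simpa only [map_smul, dotProduct_smul, smul_eq_mul] using hmF (K.smul_mem ht.le hy)
  have hvalue : 0 ≤ m none * φ x - ∑ k, m (some k) * b k := by simpa using hmF K.zero_mem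
  have hslack : ∑ k, m (some k) * a k x ≤ ∑ k, m (some k) * b k :=
    Finset.sum_le_sum fun k _ => mul_le_mul_of_nonneg_left (hxb k) (hm0 _)
  simp only [hF] at hcone
  refine ⟨m none, fun k => m (some k), hm0 _, fun k => hm0 _, ?_, ?_, ?_, fun y hy => ?_⟩
  · by_contra! h0
    exact hm (funext (Option.rec h0.1 (congrFun h0.2)))
  · linarith [hcone x hx]
  · linarith [hcone x hx]
  · linarith [hcone y hy]

end ConicPrograms

/-! ### Positive semidefinite matrices -/

section PosSemidef

variable {𝕜 n : Type*} [RCLike 𝕜] [Fintype n]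

open scoped MatrixOrder in
lemma exists_eq_conjTranspose_mul_self {W : Matrix n n 𝕜} (hW : W.PosSemidef) :
    ∃ B : Matrix n n 𝕜, W = Bᴴ * B := by
  classical exact CStarAlgebra.nonneg_iff_eq_star_mul_self.1 hW.nonneg

lemma trace_mul_nonneg {A W : Matrix n n 𝕜} (hA : A.PosSemidef) (hW : W.PosSemidef) :
    0 ≤ (A * W).trace := by
  obtain ⟨B, rfl⟩ := exists_eq_conjTranspose_mul_self hW
  rw [← mul_assoc, trace_mul_comm, ← mul_assoc]
  exact (hA.mul_mul_conjTranspose_same B).trace_nonneg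

lemma mul_eq_zero_of_re_trace_mul_eq_zero {A W : Matrix n n 𝕜} (hA : A.PosSemidef)
    (hW : W.PosSemidef) (h : RCLike.re (A * W).trace = 0) : A * W = 0 := by
  have htrace : (A * W).trace = 0 := RCLike.ext (h.trans (map_zero _).symm)
    ((RCLike.nonneg_iff.1 (trace_mul_nonneg hA hW)).2.trans (map_zero _).symm)
  obtain ⟨B, rfl⟩ := exists_eq_conjTranspose_mul_self hW
  obtain ⟨C, rfl⟩ := exists_eq_conjTranspose_mul_self hA
  have hCB : C * Bᴴ = 0 := by
    rw [← trace_conjTranspose_mul_self_eq_zero_iff, conjTranspose_mul,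
      conjTranspose_conjTranspose, ← htrace]
    simp only [mul_assoc, trace_mul_comm B]
  rw [← mul_assoc, mul_assoc Cᴴ, hCB, mul_zero, zero_mul]

lemma posSemidef_of_re_trace_mul_nonneg {A : Matrix n n 𝕜} (hA : A.IsHermitian)
    (h : ∀ W : Matrix n n 𝕜, W.PosSemidef → 0 ≤ RCLike.re (A * W).trace) : A.PosSemidef := by
  refine .of_dotProduct_mulVec_nonneg hA fun x => RCLike.nonneg_iff.2 ⟨?_, ?_⟩
  · simpa only [mul_vecMulVec, trace_vecMulVec, dotProduct_comm] using
      h _ (posSemidef_vecMulVec_self_star x)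
  · exact hA.im_star_dotProduct_mulVec_self x

lemma exists_vecMulVec_eq_smul_self_star {m : Type*} [Finite m] {v b : m → 𝕜}
    (h : (vecMulVec v b).PosSemidef) :
    ∃ a : 𝕜, vecMulVec v b = vecMulVec (a • v) (star (a • v)) := by
  cases nonempty_fintype m
  by_cases hv : v = 0
  · exact ⟨0, by simp only [hv, zero_vecMulVec, smul_zero]⟩
  have hvv : 0 < star v ⬝ᵥ v := dotProduct_star_self_pos_iff.2 hv
  have hbv : 0 ≤ b ⬝ᵥ v := by
    simpa only [trace_vecMulVec, dotProduct_comm] using h.trace_nonneg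
  have hstar : (star v ⬝ᵥ v) • star b = (b ⬝ᵥ v) • v := by
    have := congrArg (· *ᵥ v) h.isHermitian.eq
    simpa only [conjTranspose_vecMulVec, vecMulVec_mulVec, op_smul_eq_smul] using this
  obtain ⟨r, hr, hrb⟩ := RCLike.nonneg_iff_exists_ofReal.1 (div_nonneg hbv hvv.le)
  have hb : b = star ((r : 𝕜) • v) := by
    rw [hrb, div_eq_inv_mul, mul_smul, ← hstar, inv_smul_smul₀ hvv.ne', star_star]
  refine ⟨(√r : ℝ), ?_⟩
  simp only [hb, star_smul, smul_vecMulVec, vecMulVec_smul, smul_smul, RCLike.star_def,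
    RCLike.conj_ofReal, ← RCLike.ofReal_mul, Real.mul_self_sqrt hr]

lemma isCompact_setOf_posSemidef_trace_le (r : ℝ) :
    IsCompact {W : Matrix n n 𝕜 | W.PosSemidef ∧ RCLike.re W.trace ≤ r} := by
  have htrace : ∀ B : Matrix n n 𝕜, RCLike.re (Bᴴ * B).trace = ∑ j, ∑ i, ‖B i j‖ ^ 2 := by
    intro B
    simp only [trace, diag_apply, mul_apply, conjTranspose_apply, map_sum, RCLike.star_def,
      RCLike.conj_mul]
    exact_mod_cast rfl
  have hcompact : IsCompact {B : Matrix n n 𝕜 | RCLike.re (Bᴴ * B).trace ≤ r} := by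
    simp only [htrace]
    refine IsCompact.of_isClosed_subset (isCompact_univ_pi fun _ => isCompact_univ_pi fun _ =>
      isCompact_closedBall (0 : 𝕜) (√r)) (isClosed_le (by fun_prop) continuous_const)
      fun B hB i _ j _ => mem_closedBall_zero_iff.2 (Real.le_sqrt_of_sq_le ?_)
    calc ‖B i j‖ ^ 2
        ≤ ∑ i, ‖B i j‖ ^ 2 :=
          Finset.single_le_sum (f := fun i => ‖B i j‖ ^ 2) (fun _ _ => sq_nonneg _)
            (Finset.mem_univ i)
      _ ≤ ∑ j, ∑ i, ‖B i j‖ ^ 2 :=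
          Finset.single_le_sum (f := fun j => ∑ i, ‖B i j‖ ^ 2)
            (fun _ _ => Finset.sum_nonneg fun _ _ => sq_nonneg _) (Finset.mem_univ j)
      _ ≤ r := hB
  convert hcompact.image (f := fun B => Bᴴ * B) ?_ using 1
  · ext W
    constructor
    · rintro ⟨hW, hr⟩
      obtain ⟨B, rfl⟩ := exists_eq_conjTranspose_mul_self hW
      exact ⟨B, hr, rfl⟩
    · rintro ⟨B, hB, rfl⟩
      exact ⟨posSemidef_conjTranspose_mul_self B, hB⟩
  · fun_prop

end PosSemidef

/-! ### The relaxation as a conic program -/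

/-- The points of (SDR1): a covariance matrix for each information signal, and one for the energy
signal. -/
abbrev Covariances (M KI : ℕ) : Type :=
  (Fin KI → Matrix (Fin M) (Fin M) ℂ) × Matrix (Fin M) (Fin M) ℂ

/-- The cone of the points of (SDR1) with positive semidefinite components. -/
def psdCone (M KI : ℕ) : PointedCone ℝ (Covariances M KI) where
  carrier := {X | (∀ i, (X.1 i).PosSemidef) ∧ X.2.PosSemidef}
  add_mem' hX hY := ⟨fun i => (hX.1 i).add (hY.1 i), hX.2.add hY.2⟩
  zero_mem' := ⟨fun _ => .zero, .zero⟩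
  smul_mem' r _ hX := ⟨fun i => (hX.1 i).smul r.2, hX.2.smul r.2⟩

/-- The trace pairing. The objective and the constraints of (SDR1) are its values at fixed
weights. -/
noncomputable def tracePairing (M KI : ℕ) :
    Covariances M KI →ₗ[ℝ] Covariances M KI →ₗ[ℝ] ℝ :=
  LinearMap.mk₂ ℝ (fun A X => ∑ i, (A.1 i * X.1 i).trace.re + (A.2 * X.2).trace.re)
    (fun A B X => by
      simp only [Prod.fst_add, Prod.snd_add, Pi.add_apply, add_mul, trace_add, Complex.add_re,
        Finset.sum_add_distrib, add_add_add_comm])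
    (fun r A X => by
      simp only [Prod.smul_fst, Prod.smul_snd, Pi.smul_apply, smul_mul_assoc, trace_smul,
        Complex.smul_re, ← Finset.smul_sum, smul_add])
    (fun A X Y => by
      simp only [Prod.fst_add, Prod.snd_add, Pi.add_apply, mul_add, trace_add, Complex.add_re,
        Finset.sum_add_distrib, add_add_add_comm])
    (fun r A X => by
      simp only [Prod.smul_fst, Prod.smul_snd, Pi.smul_apply, mul_smul_comm, trace_smul,
        Complex.smul_re, ← Finset.smul_sum, smul_add])

lemma tracePairing_apply (A X : Covariances M KI) :
    tracePairing M KI A X = ∑ i, (A.1 i * X.1 i).trace.re + (A.2 * X.2).trace.re :=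
  rfl

lemma tracePairing_nonneg {A X : Covariances M KI} (hA : A ∈ psdCone M KI)
    (hX : X ∈ psdCone M KI) : 0 ≤ tracePairing M KI A X :=
  add_nonneg
    (Finset.sum_nonneg fun i _ => (Complex.nonneg_iff.1 (trace_mul_nonneg (hA.1 i) (hX.1 i))).1)
    (Complex.nonneg_iff.1 (trace_mul_nonneg hA.2 hX.2)).1

lemma mul_eq_zero_of_tracePairing_eq_zero {A X : Covariances M KI} (hA : A ∈ psdCone M KI)
    (hX : X ∈ psdCone M KI) (h : tracePairing M KI A X = 0) :
    (∀ i, A.1 i * X.1 i = 0) ∧ A.2 * X.2 = 0 := by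
  have hinfo : ∀ i, 0 ≤ (A.1 i * X.1 i).trace.re := fun i =>
    (Complex.nonneg_iff.1 (trace_mul_nonneg (hA.1 i) (hX.1 i))).1
  have henergy : 0 ≤ (A.2 * X.2).trace.re :=
    (Complex.nonneg_iff.1 (trace_mul_nonneg hA.2 hX.2)).1
  obtain ⟨hinfo_eq, henergy_eq⟩ :=
    (add_eq_zero_iff_of_nonneg (Finset.sum_nonneg fun i _ => hinfo i) henergy).1 h
  refine ⟨fun i => ?_, mul_eq_zero_of_re_trace_mul_eq_zero hA.2 hX.2 henergy_eq⟩
  exact mul_eq_zero_of_re_trace_mul_eq_zero (hA.1 i) (hX.1 i)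
    ((Finset.sum_eq_zero_iff_of_nonneg fun i _ => hinfo i).1 hinfo_eq i (Finset.mem_univ i))

lemma mem_psdCone_of_tracePairing_nonneg {A : Covariances M KI}
    (hA : (∀ i, (A.1 i).IsHermitian) ∧ A.2.IsHermitian)
    (h : ∀ X ∈ psdCone M KI, 0 ≤ tracePairing M KI A X) : A ∈ psdCone M KI := by
  constructor
  · intro i
    refine posSemidef_of_re_trace_mul_nonneg (hA.1 i) fun W hW => ?_
    have hmem : ((Pi.single i W, 0) : Covariances M KI) ∈ psdCone M KI := by
      refine ⟨fun k => ?_, .zero⟩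
      rcases eq_or_ne k i with rfl | hk
      · simpa only [Pi.single_eq_same] using hW
      · simpa only [Pi.single_eq_of_ne hk] using .zero
    have hpairing := h _ hmem
    rw [tracePairing_apply, Fintype.sum_eq_single i fun k hk => by simp [hk]] at hpairing
    simpa using hpairing
  · refine posSemidef_of_re_trace_mul_nonneg hA.2 fun W hW => ?_
    simpa [tracePairing_apply] using h (0, W) ⟨fun _ => .zero, hW⟩

/-- The weight that applies the matrix `A` to the total transmit covariance. -/
def uniformWeight (KI : ℕ) (A : Matrix (Fin M) (Fin M) ℂ) : Covariances M KI :=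
  (fun _ => A, A)

/-- The weight of the `i`-th SINR constraint of (SDR1). The desired signal also occurs in the
uniform interference term, which accounts for the summand `1` in `1 + 1 / γ i`. -/
noncomputable def sinrWeight (p : Params KI KE) (h : Fin KI → Fin M → ℂ) (i : Fin KI) :
    Covariances M KI :=
  (Pi.single i ((1 + 1 / p.γ i) • gram (h i)), 0) - uniformWeight KI (gram (h i))

lemma sdr1Objective_eq_tracePairing (p : Params KI KE) (g : Fin KE → Fin M → ℂ)
    (X : Covariances M KI) :
    sdr1Objective p g X = tracePairing M KI (uniformWeight KI (energyMatrix p g)) X :=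
  rfl

lemma tracePairing_uniformWeight_one (X : Covariances M KI) :
    tracePairing M KI (uniformWeight KI 1) X = ∑ i, (X.1 i).trace.re + X.2.trace.re := by
  simp only [tracePairing_apply, uniformWeight, one_mul]

lemma tracePairing_sinrWeight (p : Params KI KE) (h : Fin KI → Fin M → ℂ) (i : Fin KI)
    (X : Covariances M KI) : tracePairing M KI (sinrWeight p h i) X =
      (gram (h i) * X.1 i).trace.re / p.γ i
        - ∑ k ∈ Finset.univ.erase i, (gram (h i) * X.1 k).trace.re
        - (gram (h i) * X.2).trace.re := by
  have hsingle : tracePairing M KI (Pi.single i ((1 + 1 / p.γ i) • gram (h i)), 0) X =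
      (1 + 1 / p.γ i) * (gram (h i) * X.1 i).trace.re := by
    rw [tracePairing_apply, Fintype.sum_eq_single i fun k hk => by simp [hk]]
    simp
  rw [sinrWeight, map_sub, LinearMap.sub_apply, hsingle, tracePairing_apply, uniformWeight,
    Finset.sum_erase_eq_sub (Finset.mem_univ i)]
  ring

lemma mem_sdr1Feasible_iff {h : Fin KI → Fin M → ℂ} {X : Covariances M KI} :
    X ∈ sdr1Feasible p h ↔ X ∈ psdCone M KI ∧
      tracePairing M KI (uniformWeight KI 1) X ≤ p.P ∧
      ∀ i, p.σ i ^ 2 ≤ tracePairing M KI (sinrWeight p h i) X := by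
  simp only [tracePairing_uniformWeight_one, tracePairing_sinrWeight, ← sub_nonneg (b := p.σ _ ^ 2)]
  exact ⟨fun ⟨hsinr, hP, hpsd⟩ => ⟨hpsd, hP, hsinr⟩, fun ⟨hpsd, hP, hsinr⟩ => ⟨hsinr, hP, hpsd⟩⟩

lemma mem_psdCone_of_mem_sdr1Feasible {h : Fin KI → Fin M → ℂ} {X : Covariances M KI}
    (hX : X ∈ sdr1Feasible p h) : X ∈ psdCone M KI :=
  (mem_sdr1Feasible_iff.1 hX).1

lemma isCompact_sdr1Feasible (p : Params KI KE) (h : Fin KI → Fin M → ℂ) :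
    IsCompact (sdr1Feasible p h) := by
  let T : Set (Matrix (Fin M) (Fin M) ℂ) := {W | W.PosSemidef ∧ W.trace.re ≤ p.P}
  have hT : IsCompact T := isCompact_setOf_posSemidef_trace_le p.P
  have hcontinuous : ∀ A, Continuous (tracePairing M KI A) := fun A =>
    LinearMap.continuous_of_finiteDimensional _
  have hclosed : IsClosed {X | tracePairing M KI (uniformWeight KI 1) X ≤ p.P ∧
      ∀ i, p.σ i ^ 2 ≤ tracePairing M KI (sinrWeight p h i) X} := by
    simp only [Set.ofPred_and, Set.ofPred_forall]
    exact (isClosed_le (hcontinuous _) continuous_const).inter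
      (isClosed_iInter fun i => isClosed_le continuous_const (hcontinuous _))
  convert ((isCompact_univ_pi fun _ => hT).prod hT).inter_right hclosed using 1
  ext X
  rw [mem_sdr1Feasible_iff]
  constructor
  · rintro ⟨hpsd, hX⟩
    have hinfo : ∀ i, 0 ≤ (X.1 i).trace.re := fun i =>
      (Complex.nonneg_iff.1 (hpsd.1 i).trace_nonneg).1
    have henergy : 0 ≤ X.2.trace.re := (Complex.nonneg_iff.1 hpsd.2.trace_nonneg).1
    have hpower := (tracePairing_uniformWeight_one X).symm.trans_le hX.1
    have hsum : ∑ i, (X.1 i).trace.re ≤ p.P := (le_add_of_nonneg_right henergy).trans hpower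
    refine ⟨⟨fun i _ => ⟨hpsd.1 i, ?_⟩, hpsd.2, ?_⟩, hX⟩
    · exact (Finset.single_le_sum (fun k _ => hinfo k) (Finset.mem_univ i)).trans hsum
    · exact (le_add_of_nonneg_left (Finset.sum_nonneg fun i _ => hinfo i)).trans hpower
  · rintro ⟨⟨hinfo, henergy⟩, hX⟩
    exact ⟨⟨fun i => (hinfo i trivial).1, henergy.1⟩, hX⟩

lemma exists_isSDR1Optimal (p : Params KI KE) {h : Fin KI → Fin M → ℂ} (g : Fin KE → Fin M → ℂ)
    (hne : (sdr1Feasible p h).Nonempty) : ∃ X, IsSDR1Optimal p h g X := by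
  have hcontinuous : Continuous (sdr1Objective p g) := LinearMap.continuous_of_finiteDimensional
    (tracePairing M KI (uniformWeight KI (energyMatrix p g)))
  exact (isCompact_sdr1Feasible p h).exists_isMaxOn hne hcontinuous.continuousOn

/-! ### Beams and covariances -/

lemma posSemidef_gram (h : Fin M → ℂ) : (gram h).PosSemidef :=
  posSemidef_vecMulVec_star_self h

lemma isHermitian_gram (h : Fin M → ℂ) : (gram h).IsHermitian :=
  (posSemidef_gram h).isHermitian

lemma energyMatrix_eq_smul_sum (p : Params KI KE) (g : Fin KE → Fin M → ℂ) :
    energyMatrix p g = p.ζ • ∑ j, p.α j • gram (g j) := by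
  simp only [energyMatrix, Complex.coe_smul]

lemma isHermitian_energyMatrix (p : Params KI KE) (g : Fin KE → Fin M → ℂ) :
    (energyMatrix p g).IsHermitian := by
  rw [energyMatrix_eq_smul_sum]
  exact .smul (isSelfAdjoint_sum _ fun j _ => (isHermitian_gram (g j)).smul (.all _)) (.all _)

lemma posSemidef_energyMatrix (hζ : 0 ≤ p.ζ) (hα : ∀ j, 0 ≤ p.α j) (g : Fin KE → Fin M → ℂ) :
    (energyMatrix p g).PosSemidef := by
  rw [energyMatrix_eq_smul_sum]
  exact (posSemidef_sum _ fun j _ => (posSemidef_gram (g j)).smul (hα j)).smul hζ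

lemma gram_mulVec (h x : Fin M → ℂ) : gram h *ᵥ x = (h ⬝ᵥ x) • star h := by
  rw [gram, vecMulVec_mulVec, op_smul_eq_smul]

lemma star_dotProduct_gram_mulVec (h x : Fin M → ℂ) :
    star x ⬝ᵥ gram h *ᵥ x = ((‖h ⬝ᵥ x‖ ^ 2 : ℝ) : ℂ) := by
  rw [gram_mulVec, dotProduct_smul, star_dotProduct_star, smul_eq_mul, Complex.ofReal_pow,
    ← Complex.mul_conj']
  rfl

lemma star_dotProduct_self (x : Fin M → ℂ) : star x ⬝ᵥ x = (sqNorm x : ℂ) := by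
  simp [dotProduct, sqNorm, Complex.conj_mul']

lemma trace_mul_outer (A : Matrix (Fin M) (Fin M) ℂ) (w : Fin M → ℂ) :
    (A * outer w).trace = star w ⬝ᵥ A *ᵥ w := by
  rw [outer, mul_vecMulVec, trace_vecMulVec, dotProduct_comm]

lemma trace_gram_mul_outer (h w : Fin M → ℂ) :
    (gram h * outer w).trace = ((‖h ⬝ᵥ w‖ ^ 2 : ℝ) : ℂ) := by
  rw [trace_mul_outer, star_dotProduct_gram_mulVec]

lemma trace_outer (w : Fin M → ℂ) : (outer w).trace = (sqNorm w : ℂ) := by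
  rw [outer, trace_vecMulVec, dotProduct_comm, star_dotProduct_self]

lemma rank_outer {w : Fin M → ℂ} (hw : outer w ≠ 0) : (outer w).rank = 1 := by
  refine le_antisymm (rank_vecMulVec_le _ _) (Nat.one_le_iff_ne_zero.2 fun h0 => hw ?_)
  rw [Matrix.rank, Submodule.finrank_eq_zero, LinearMap.range_eq_bot] at h0
  exact Matrix.toLin'.map_eq_zero_iff.1 h0

/-- The covariance matrices of a choice of beams. -/
def toCovariances (x : (Fin KI → Fin M → ℂ) × (Fin KE → Fin M → ℂ)) : Covariances M KI :=
  (fun i => outer (x.1 i), ∑ j, outer (x.2 j))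

lemma toCovariances_zero_right (w : Fin KI → Fin M → ℂ) :
    toCovariances (w, (0 : Fin KE → Fin M → ℂ)) = (fun i => outer (w i), 0) := by
  simp [toCovariances, outer]

lemma sdr1Objective_toCovariances (p : Params KI KE) (g : Fin KE → Fin M → ℂ)
    (x : (Fin KI → Fin M → ℂ) × (Fin KE → Fin M → ℂ)) :
    sdr1Objective p g (toCovariances x) = p1Objective p g x := by
  simp only [sdr1Objective, toCovariances, p1Objective, Finset.mul_sum, trace_sum, Complex.re_sum,
    trace_mul_outer]

lemma toCovariances_mem_sdr1Feasible_iff (hσ : ∀ i, 0 < p.σ i) (hγ : ∀ i, 0 < p.γ i)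
    {h : Fin KI → Fin M → ℂ} {x : (Fin KI → Fin M → ℂ) × (Fin KE → Fin M → ℂ)} :
    toCovariances x ∈ sdr1Feasible p h ↔ x ∈ p1Feasible p h := by
  have hpsd : toCovariances x ∈ psdCone M KI :=
    ⟨fun i => posSemidef_vecMulVec_self_star _,
      posSemidef_sum _ fun j _ => posSemidef_vecMulVec_self_star _⟩
  have hpower : tracePairing M KI (uniformWeight KI 1) (toCovariances x) =
      ∑ i, sqNorm (x.1 i) + ∑ j, sqNorm (x.2 j) := by
    simp only [tracePairing_uniformWeight_one, toCovariances, trace_sum, trace_outer,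
      Complex.re_sum, Complex.ofReal_re]
  have hsinr : ∀ i, p.σ i ^ 2 ≤ tracePairing M KI (sinrWeight p h i) (toCovariances x) ↔
      p.γ i ≤ sinrI p h x i := by
    intro i
    have hnoise : 0 < ∑ k ∈ Finset.univ.erase i, ‖h i ⬝ᵥ x.1 k‖ ^ 2 +
        ∑ j, ‖h i ⬝ᵥ x.2 j‖ ^ 2 + p.σ i ^ 2 := by
      have := pow_pos (hσ i) 2
      positivity
    rw [sinrI, le_div_iff₀ hnoise, mul_comm, ← le_div_iff₀ (hγ i)]
    simp only [tracePairing_sinrWeight, toCovariances, Finset.mul_sum, trace_sum, Complex.re_sum,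
      trace_gram_mul_outer, Complex.ofReal_re]
    constructor <;> intro _ <;> linarith
  simp only [mem_sdr1Feasible_iff, hpsd, hpower, hsinr, true_and]
  exact and_comm

lemma isP1Optimal_of_isSDR1Optimal_toCovariances (hσ : ∀ i, 0 < p.σ i) (hγ : ∀ i, 0 < p.γ i)
    {h : Fin KI → Fin M → ℂ} {g : Fin KE → Fin M → ℂ}
    {x : (Fin KI → Fin M → ℂ) × (Fin KE → Fin M → ℂ)}
    (hx : IsSDR1Optimal p h g (toCovariances x)) : IsP1Optimal p h g x := by
  refine ⟨(toCovariances_mem_sdr1Feasible_iff hσ hγ).1 hx.1, fun y hy => ?_⟩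
  have hle := hx.2 ((toCovariances_mem_sdr1Feasible_iff hσ hγ).2 hy)
  simpa only [Set.mem_ofPred_eq, sdr1Objective_toCovariances] using hle

lemma ne_zero_of_mem_sdr1Feasible (hσ : ∀ i, 0 < p.σ i) {h : Fin KI → Fin M → ℂ}
    {X : Covariances M KI} (hX : X ∈ sdr1Feasible p h) (i : Fin KI) : X.1 i ≠ 0 := by
  intro h0
  have hsinr := (mem_sdr1Feasible_iff.1 hX).2.2 i
  have hpsd := mem_psdCone_of_mem_sdr1Feasible hX
  have hgram : ∀ {W : Matrix (Fin M) (Fin M) ℂ}, W.PosSemidef → 0 ≤ (gram (h i) * W).trace.re :=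
    fun hW => (Complex.nonneg_iff.1 (trace_mul_nonneg (posSemidef_gram _) hW)).1
  rw [tracePairing_sinrWeight, h0, mul_zero, trace_zero, Complex.zero_re, zero_div] at hsinr
  linarith [pow_pos (hσ i) 2, hgram hpsd.2,
    Finset.sum_nonneg fun k (_ : k ∈ Finset.univ.erase i) => hgram (hpsd.1 k)]

lemma drop_energy_mem_sdr1Feasible {h : Fin KI → Fin M → ℂ} {X : Covariances M KI}
    (hX : X ∈ sdr1Feasible p h) : (X.1, 0) ∈ sdr1Feasible p h := by
  obtain ⟨hsinr, hP, hinfo, henergy⟩ := hX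
  have htrace : 0 ≤ X.2.trace.re := (Complex.nonneg_iff.1 henergy.trace_nonneg).1
  refine ⟨fun i => ?_, ?_, hinfo, .zero⟩
  · have hgram : 0 ≤ (gram (h i) * X.2).trace.re :=
      (Complex.nonneg_iff.1 (trace_mul_nonneg (posSemidef_gram _) henergy)).1
    rw [mul_zero, trace_zero, Complex.zero_re]
    linarith [hsinr i]
  · rw [trace_zero, Complex.zero_re]
    linarith

/-! ### Dual certificates -/

/-- The dual slack of (SDR1), for a multiplier `c` of the objective, `β` of the power constraint
and `l` of the SINR constraints. -/
noncomputable def dualSlack (p : Params KI KE) (h : Fin KI → Fin M → ℂ) (g : Fin KE → Fin M → ℂ)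
    (c β : ℝ) (l : Fin KI → ℝ) : Covariances M KI :=
  β • uniformWeight KI 1 - ∑ k, l k • sinrWeight p h k - c • uniformWeight KI (energyMatrix p g)

section DualSlack

variable (p : Params KI KE) (h : Fin KI → Fin M → ℂ) (g : Fin KE → Fin M → ℂ) (c β : ℝ)
  (l : Fin KI → ℝ)

lemma dualSlack_snd : (dualSlack p h g c β l).2 =
    β • (1 : Matrix (Fin M) (Fin M) ℂ) + ∑ k, l k • gram (h k) - c • energyMatrix p g := by
  simp [dualSlack, sinrWeight, uniformWeight, Prod.snd_sum]

lemma dualSlack_fst (i : Fin KI) : (dualSlack p h g c β l).1 i =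
    (dualSlack p h g c β l).2 - (l i * (1 + 1 / p.γ i)) • gram (h i) := by
  have hsingle : ∑ k, l k • (Pi.single k ((1 + 1 / p.γ k) • gram (h k)) :
      Fin KI → Matrix (Fin M) (Fin M) ℂ) i = (l i * (1 + 1 / p.γ i)) • gram (h i) := by
    rw [Fintype.sum_eq_single i fun k hk => by rw [Pi.single_eq_of_ne hk.symm, smul_zero],
      Pi.single_eq_same, smul_smul]
  simp only [dualSlack, sinrWeight, uniformWeight, Prod.fst_sub, Prod.snd_sub, Prod.smul_fst,
    Prod.smul_snd, Prod.fst_sum, Prod.snd_sum, Pi.sub_apply, Pi.smul_apply, Finset.sum_apply,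
    smul_sub, Finset.sum_sub_distrib, hsingle, smul_zero, Finset.sum_const_zero]
  abel

lemma isHermitian_dualSlack :
    (∀ i, ((dualSlack p h g c β l).1 i).IsHermitian) ∧ (dualSlack p h g c β l).2.IsHermitian := by
  have hsum : (∑ k, l k • gram (h k)).IsHermitian :=
    isSelfAdjoint_sum _ fun k _ => (isHermitian_gram (h k)).smul (.all (l k))
  have hsnd : (dualSlack p h g c β l).2.IsHermitian := by
    rw [dualSlack_snd]
    exact ((isHermitian_one.smul (.all β)).add hsum).sub
      ((isHermitian_energyMatrix p g).smul (.all c))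
  refine ⟨fun i => ?_, hsnd⟩
  rw [dualSlack_fst]
  exact hsnd.sub ((isHermitian_gram (h i)).smul (.all _))

lemma tracePairing_dualSlack (X : Covariances M KI) :
    tracePairing M KI (dualSlack p h g c β l) X =
      β * tracePairing M KI (uniformWeight KI 1) X
        - ∑ k, l k * tracePairing M KI (sinrWeight p h k) X - c * sdr1Objective p g X := by
  simp only [dualSlack, map_sub, map_sum, map_smul, LinearMap.sub_apply, LinearMap.sum_apply,
    LinearMap.smul_apply, smul_eq_mul, sdr1Objective_eq_tracePairing]

end DualSlack

/-- Fritz John multipliers certifying the optimality of `X` for (SDR1). -/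
structure IsDualCertificate (p : Params KI KE) (h : Fin KI → Fin M → ℂ) (g : Fin KE → Fin M → ℂ)
    (X : Covariances M KI) (c β : ℝ) (l : Fin KI → ℝ) : Prop where
  objective_nonneg : 0 ≤ c
  power_nonneg : 0 ≤ β
  sinr_nonneg : 0 ≤ l
  ne_zero : c ≠ 0 ∨ β ≠ 0 ∨ l ≠ 0
  value : c * sdr1Objective p g X + ∑ i, l i * p.σ i ^ 2 = β * p.P
  slack_mem : dualSlack p h g c β l ∈ psdCone M KI
  slack_mul_info : ∀ i, (dualSlack p h g c β l).1 i * X.1 i = 0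
  slack_mul_energy : (dualSlack p h g c β l).2 * X.2 = 0

variable {h : Fin KI → Fin M → ℂ} {g : Fin KE → Fin M → ℂ} {X : Covariances M KI}

lemma exists_isDualCertificate (hX : IsSDR1Optimal p h g X) :
    ∃ c β l, IsDualCertificate p h g X c β l := by
  obtain ⟨hpsd, hP, hsinr⟩ := mem_sdr1Feasible_iff.1 hX.1
  obtain ⟨c, m, hc, hm, hne, hvalue, hX0, hcone⟩ := exists_conic_multipliers
    (φ := tracePairing M KI (uniformWeight KI (energyMatrix p g)))
    (a := fun k => k.elim (tracePairing M KI (uniformWeight KI 1))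
      fun i => -tracePairing M KI (sinrWeight p h i))
    (b := fun k => k.elim p.P fun i => -p.σ i ^ 2) hpsd
    (Option.rec hP fun i => neg_le_neg (hsinr i))
    fun Y hY hYb => hX.2 (mem_sdr1Feasible_iff.2
      ⟨hY, hYb none, fun i => neg_le_neg_iff.1 (hYb (some i))⟩)
  simp only [Fintype.sum_option, Option.elim_none, Option.elim_some, LinearMap.neg_apply, mul_neg,
    Finset.sum_neg_distrib, ← sdr1Objective_eq_tracePairing] at hvalue hX0 hcone
  have hslack := tracePairing_dualSlack p h g c (m none) fun i => m (some i)
  have hmem : dualSlack p h g c (m none) (fun i => m (some i)) ∈ psdCone M KI :=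
    mem_psdCone_of_tracePairing_nonneg (isHermitian_dualSlack ..) fun Y hY => by
      rw [hslack]
      linarith [hcone Y hY]
  obtain ⟨hinfo, henergy⟩ := mul_eq_zero_of_tracePairing_eq_zero hmem hpsd <| by
    rw [hslack]
    linarith
  refine ⟨c, m none, fun i => m (some i), hc, hm none, fun i => hm (some i), ?_, ?_, hmem, hinfo,
    henergy⟩
  · by_contra! h0
    exact hne.elim (· h0.1) (· (funext (Option.rec h0.2.1 (congrFun h0.2.2))))
  · linarith

/-! ### Structure of the optimal covariances -/

lemma exists_eq_vecMulVec_of_mul_eq_zero {n R : Type*} [Fintype n] [CommSemiring R]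
    {A X : Matrix n n R} {v : n → R} (hA : ∀ x, A *ᵥ x = 0 → ∃ b : R, x = b • v)
    (hAX : A * X = 0) : ∃ b, X = vecMulVec v b := by
  choose b hb using fun m => hA (X.col m) (funext fun k => congrFun (congrFun hAX k) m)
  refine ⟨b, ext fun k m => ?_⟩
  rw [vecMulVec_apply, mul_comm]
  exact congrFun (hb m) k

lemma isUnit_of_mulVec_eq_zero {n K : Type*} [Fintype n] [DecidableEq n] [Field K]
    {A : Matrix n n K} (hA : ∀ x, A *ᵥ x = 0 → x = 0) : IsUnit A := by
  rw [← mulVec_injective_iff_isUnit, ← coe_mulVecLin, injective_iff_map_eq_zero]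
  exact hA

lemma sqNorm_smul (a : ℂ) (x : Fin M → ℂ) : sqNorm (a • x) = ‖a‖ ^ 2 * sqNorm x := by
  simp only [sqNorm, Pi.smul_apply, norm_smul, mul_pow, Finset.mul_sum]

lemma sqNorm_pos {x : Fin M → ℂ} (hx : x ≠ 0) : 0 < sqNorm x := by
  have hpos := dotProduct_star_self_pos_iff.2 hx
  rwa [star_dotProduct_self, Complex.zero_lt_real] at hpos

lemma exists_sqNorm_smul_eq_one {x : Fin M → ℂ} (hx : x ≠ 0) :
    ∃ r : ℂ, sqNorm (r • x) = 1 := by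
  refine ⟨((√(sqNorm x))⁻¹ : ℝ), ?_⟩
  rw [sqNorm_smul, Complex.norm_real, Real.norm_eq_abs, sq_abs, inv_pow,
    Real.sq_sqrt (sqNorm_pos hx).le, inv_mul_cancel₀ (sqNorm_pos hx).ne']

lemma oeBFFeasible_of_aligned {v : Fin M → ℂ} (hv : IsDominantEigenvector (energyMatrix p g) v)
    {a : Fin KI → ℂ}
    (ha : (fun i => a i • v, (0 : Fin KE → Fin M → ℂ)) ∈ p1Feasible p h) :
    OeBFFeasible p h g := by
  refine ⟨v, hv, fun i => ‖a i‖ ^ 2, fun i => sq_nonneg _, fun i => ?_, ?_⟩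
  · simpa [sinrI, mul_pow] using ha.1 i
  · have hzero : sqNorm (0 : Fin M → ℂ) = 0 := by simp [sqNorm]
    simpa [sqNorm_smul, hv.1, hzero] using ha.2

namespace IsDualCertificate

variable {c β : ℝ} {l : Fin KI → ℝ}

lemma power_pos (hcert : IsDualCertificate p h g X c β l) (hσ : ∀ i, 0 < p.σ i)
    (hG : (energyMatrix p g).PosSemidef) (hG0 : energyMatrix p g ≠ 0)
    (hX : X ∈ psdCone M KI) : 0 < β := by
  refine hcert.power_nonneg.lt_of_ne' fun hβ => ?_
  subst hβ
  have hobjective : 0 ≤ c * sdr1Objective p g X := by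
    rw [sdr1Objective_eq_tracePairing]
    exact mul_nonneg hcert.objective_nonneg (tracePairing_nonneg ⟨fun _ => hG, hG⟩ hX)
  have hnoise : ∀ i, 0 ≤ l i * p.σ i ^ 2 := fun i => mul_nonneg (hcert.sinr_nonneg i) (sq_nonneg _)
  have hl : l = 0 := by
    have hsum := ((add_eq_zero_iff_of_nonneg hobjective (Finset.sum_nonneg fun i _ => hnoise i)).1
      (hcert.value.trans (zero_mul _))).2
    funext i
    exact (mul_eq_zero.1 ((Finset.sum_eq_zero_iff_of_nonneg fun i _ => hnoise i).1 hsum i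
      (Finset.mem_univ i))).resolve_right (pow_pos (hσ i) 2).ne'
  subst hl
  have hc : c ≠ 0 := hcert.ne_zero.resolve_right (by simp)
  have hneg : (-(c • energyMatrix p g)).PosSemidef := by
    simpa [dualSlack_snd] using hcert.slack_mem.2
  have hcG := hG.smul hcert.objective_nonneg
  have htrace : (c • energyMatrix p g).trace = 0 :=
    le_antisymm (by simpa using hneg.trace_nonneg) hcG.trace_nonneg
  exact smul_ne_zero hc hG0 (hcG.trace_eq_zero_iff.1 htrace)

lemma smul_dotProduct_eq_zero (hcert : IsDualCertificate p h g X c β l) (hγ : ∀ i, 0 < p.γ i)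
    {x : Fin M → ℂ} (hx : (dualSlack p h g c β l).2 *ᵥ x = 0) (i : Fin KI) :
    l i • (h i ⬝ᵥ x) = 0 := by
  have hweight : 0 < 1 + 1 / p.γ i := by
    have := hγ i
    positivity
  have hquad := (hcert.slack_mem.1 i).dotProduct_mulVec_nonneg x
  rw [dualSlack_fst, sub_mulVec, hx, zero_sub, smul_mulVec, dotProduct_neg, dotProduct_smul,
    star_dotProduct_gram_mulVec, Complex.real_smul, ← Complex.ofReal_mul, ← Complex.ofReal_neg,
    Complex.zero_le_real, neg_nonneg, mul_right_comm] at hquad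
  have hsq : l i * ‖h i ⬝ᵥ x‖ ^ 2 = 0 := le_antisymm
    (nonpos_of_mul_nonpos_left hquad hweight) (mul_nonneg (hcert.sinr_nonneg i) (sq_nonneg _))
  simpa using hsq

lemma smul_energyMatrix_mulVec (hcert : IsDualCertificate p h g X c β l) (hγ : ∀ i, 0 < p.γ i)
    {x : Fin M → ℂ} (hx : (dualSlack p h g c β l).2 *ᵥ x = 0) :
    c • energyMatrix p g *ᵥ x = β • x := by
  have hsinr : ∀ k, l k • gram (h k) *ᵥ x = 0 := fun k => by
    rw [gram_mulVec, ← smul_assoc, hcert.smul_dotProduct_eq_zero hγ hx, zero_smul]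
  simpa only [dualSlack_snd, sub_mulVec, add_mulVec, sum_mulVec, smul_mulVec, one_mulVec, hsinr,
    Finset.sum_const_zero, add_zero, sub_eq_zero, eq_comm] using hx

lemma energyMatrix_mulVec (hcert : IsDualCertificate p h g X c β l) (hγ : ∀ i, 0 < p.γ i)
    (hc : c ≠ 0) {x : Fin M → ℂ} (hx : (dualSlack p h g c β l).2 *ᵥ x = 0) :
    energyMatrix p g *ᵥ x = ((β / c : ℝ) : ℂ) • x := by
  rw [Complex.coe_smul, div_eq_inv_mul, mul_smul, ← hcert.smul_energyMatrix_mulVec hγ hx,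
    inv_smul_smul₀ hc]

lemma isUnit_slack (hcert : IsDualCertificate p h g X c β l) (hγ : ∀ i, 0 < p.γ i)
    (hh : ∀ i, ¬ AnnihilatesEigenvector (energyMatrix p g) (h i)) (hβ : β ≠ 0)
    (hcl : c = 0 ∨ l ≠ 0) : IsUnit (dualSlack p h g c β l).2 := by
  refine isUnit_of_mulVec_eq_zero fun x hx => ?_
  by_contra hx0
  have hc : c ≠ 0 := by
    rintro rfl
    exact smul_ne_zero hβ hx0 (by simpa using (hcert.smul_energyMatrix_mulVec hγ hx).symm)
  obtain ⟨i, hi⟩ := Function.ne_iff.1 (hcl.resolve_left hc)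
  exact hh i ⟨_, Complex.ofReal_ne_zero.2 (div_ne_zero hβ hc), x, hx0,
    hcert.energyMatrix_mulVec hγ hc hx,
    (smul_eq_zero.1 (hcert.smul_dotProduct_eq_zero hγ hx i)).resolve_left hi⟩

lemma isDominantEigenvector (hcert : IsDualCertificate p h g X c β 0) (hγ : ∀ i, 0 < p.γ i)
    (hc : c ≠ 0) {v : Fin M → ℂ} (hv : sqNorm v = 1)
    (hEv : (dualSlack p h g c β 0).2 *ᵥ v = 0) :
    IsDominantEigenvector (energyMatrix p g) v := by
  refine ⟨hv, β / c, hcert.energyMatrix_mulVec hγ hc hEv, fun ν hν => ?_⟩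
  obtain ⟨x, hx, hx0⟩ := hν.exists_hasEigenvector
  have hGx : energyMatrix p g *ᵥ x = ν • x := Module.End.mem_eigenspace_iff.1 hx
  have hslack : (dualSlack p h g c β 0).2 *ᵥ x = (β - c * ν) • x := by
    simp only [dualSlack_snd, Pi.zero_apply, zero_smul, Finset.sum_const_zero, add_zero,
      sub_mulVec, smul_mulVec, one_mulVec, hGx, smul_smul, sub_smul]
  have hquad := hcert.slack_mem.2.dotProduct_mulVec_nonneg x
  rw [hslack, dotProduct_smul, star_dotProduct_self, Complex.real_smul, ← Complex.ofReal_mul,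
    Complex.zero_le_real] at hquad
  rw [le_div_iff₀' (hcert.objective_nonneg.lt_of_ne' hc)]
  exact sub_nonneg.1 (nonneg_of_mul_nonneg_left hquad (sqNorm_pos hx0))

lemma exists_sqNorm_eq_one_mulVec_eq_zero (hcert : IsDualCertificate p h g X c β 0)
    (hP : 0 < p.P) (hβ : 0 < β) :
    ∃ v : Fin M → ℂ, sqNorm v = 1 ∧ (dualSlack p h g c β 0).2 *ᵥ v = 0 := by
  obtain ⟨x, hx, hx0⟩ : ∃ x, (dualSlack p h g c β 0).2 *ᵥ x = 0 ∧ x ≠ 0 := by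
    by_contra! hker
    have hE := isUnit_of_mulVec_eq_zero hker
    have hinfo : X.1 = 0 := funext fun i => hE.mul_right_eq_zero.1 <| by
      simpa [dualSlack_fst] using hcert.slack_mul_info i
    have henergy : X.2 = 0 := hE.mul_right_eq_zero.1 hcert.slack_mul_energy
    have hvalue : 0 = β * p.P := by
      simpa [sdr1Objective, hinfo, henergy] using hcert.value
    exact (mul_pos hβ hP).ne hvalue
  obtain ⟨r, hr⟩ := exists_sqNorm_smul_eq_one hx0
  exact ⟨r • x, hr, by rw [mulVec_smul, hx, smul_zero]⟩

lemma oeBFFeasible (hcert : IsDualCertificate p h g X c β 0) (hP : 0 < p.P)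
    (hσ : ∀ i, 0 < p.σ i) (hγ : ∀ i, 0 < p.γ i) (hs : SimpleNonzeroSpectrum (energyMatrix p g))
    (hX : X ∈ sdr1Feasible p h) (hc : c ≠ 0) (hβ : 0 < β) : OeBFFeasible p h g := by
  obtain ⟨v, hv, hEv⟩ := hcert.exists_sqNorm_eq_one_mulVec_eq_zero hP hβ
  have hv0 : v ≠ 0 := by
    rintro rfl
    simp [sqNorm] at hv
  have hker : ∀ x, (dualSlack p h g c β 0).2 *ᵥ x = 0 → ∃ b : ℂ, x = b • v := fun x hx =>
    hs _ (Complex.ofReal_ne_zero.2 (div_ne_zero hβ.ne' hc)) v x hv0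
      (hcert.energyMatrix_mulVec hγ hc hEv) (hcert.energyMatrix_mulVec hγ hc hx)
  have haligned : ∀ i, ∃ a : ℂ, X.1 i = outer (a • v) := fun i => by
    obtain ⟨b, hb⟩ := exists_eq_vecMulVec_of_mul_eq_zero hker (X := X.1 i) <| by
      simpa [dualSlack_fst] using hcert.slack_mul_info i
    rw [hb]
    exact exists_vecMulVec_eq_smul_self_star (hb ▸ hX.2.2.1 i)
  choose a ha using haligned
  refine oeBFFeasible_of_aligned (hcert.isDominantEigenvector hγ hc hv hEv) (a := a) ?_
  rw [← toCovariances_mem_sdr1Feasible_iff hσ hγ, toCovariances_zero_right, ← funext ha]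
  exact drop_energy_mem_sdr1Feasible hX

lemma exists_eq_outer (hcert : IsDualCertificate p h g X c β l)
    (hE : IsUnit (dualSlack p h g c β l).2) (hX : X ∈ psdCone M KI) (i : Fin KI) :
    ∃ w, X.1 i = outer w := by
  have hinv : (dualSlack p h g c β l).2 * X.1 i =
      vecMulVec ((l i * (1 + 1 / p.γ i)) • star (h i)) (h i ᵥ* X.1 i) := by
    have hinfo := hcert.slack_mul_info i
    rwa [dualSlack_fst, sub_mul, sub_eq_zero, smul_mul, gram, vecMulVec_mul,
      ← smul_vecMulVec] at hinfo
  have hvec := nonsing_inv_mul_cancel_left _ (X.1 i) ((isUnit_iff_isUnit_det _).1 hE)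
  rw [hinv, mul_vecMulVec] at hvec
  obtain ⟨a, ha⟩ := exists_vecMulVec_eq_smul_self_star (hvec ▸ hX.1 i)
  exact ⟨_, hvec.symm.trans ha⟩

end IsDualCertificate

lemma IsSDR1Optimal.exists_eq_toCovariances (hX : IsSDR1Optimal p h g X) (hP : 0 < p.P)
    (hσ : ∀ i, 0 < p.σ i) (hγ : ∀ i, 0 < p.γ i) (hG : (energyMatrix p g).PosSemidef)
    (hgen : IsGeneric (energyMatrix p g) h) (hO : ¬ OeBFFeasible p h g) :
    ∃ w : Fin KI → Fin M → ℂ, X = toCovariances (w, (0 : Fin KE → Fin M → ℂ)) := by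
  obtain ⟨c, β, l, hcert⟩ := exists_isDualCertificate hX
  have hpsd := mem_psdCone_of_mem_sdr1Feasible hX.1
  have hβ := hcert.power_pos hσ hG hgen.ne_zero hpsd
  have hcl : c = 0 ∨ l ≠ 0 := by
    by_contra! hcl
    obtain ⟨hc, rfl⟩ := hcl
    exact hO (hcert.oeBFFeasible hP hσ hγ hgen.simple hX.1 hc hβ)
  have hE := hcert.isUnit_slack hγ hgen.not_annihilatesEigenvector hβ.ne' hcl
  choose w hw using hcert.exists_eq_outer hE hpsd
  refine ⟨w, ?_⟩
  rw [toCovariances_zero_right]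
  exact Prod.ext (funext hw) (hE.mul_right_eq_zero.1 hcert.slack_mul_energy)

end SWIPT

theorem proposition3p1 {M KI KE : ℕ} (hM : 1 < M) (p : SWIPT.Params KI KE)
    (hP : 0 < p.P) (hζ : 0 < p.ζ ∧ p.ζ ≤ 1) (hσ : ∀ i, 0 < p.σ i) (hγ : ∀ i, 0 < p.γ i)
    (hα : ∀ j, 0 ≤ p.α j) (hα' : ∃ j, 0 < p.α j)
    {Ω : Type*} [MeasurableSpace Ω] (μ : MeasureTheory.Measure Ω)
    [MeasureTheory.IsProbabilityMeasure μ]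
    (h : Fin KI → Ω → Fin M → ℂ) (g : Fin KE → Ω → Fin M → ℂ)
    (hchan : SWIPT.IndependentChannels μ h g) :
    ∀ᵐ ω ∂μ,
      (SWIPT.sdr1Feasible p (fun i => h i ω)).Nonempty →
      ¬ SWIPT.OeBFFeasible p (fun i => h i ω) (fun j => g j ω) →
      (∃ X, SWIPT.IsSDR1Optimal p (fun i => h i ω) (fun j => g j ω) X) ∧
      ∀ X, SWIPT.IsSDR1Optimal p (fun i => h i ω) (fun j => g j ω) X →
        (∀ i, (X.1 i).rank = 1) ∧ X.2 = 0 ∧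
        ∃ w : Fin KI → Fin M → ℂ, (∀ i, X.1 i = SWIPT.outer (w i)) ∧
          SWIPT.IsP1Optimal p (fun i => h i ω) (fun j => g j ω) (w, 0) ∧
          SWIPT.p1Objective p (fun j => g j ω) (w, 0) =
            SWIPT.sdr1Objective p (fun j => g j ω) X := by
  have : NeZero M := ⟨by lia⟩
  filter_upwards [SWIPT.ae_isGeneric hζ.1 hα hα' hchan] with ω hgen hne hO
  have hG := SWIPT.posSemidef_energyMatrix hζ.1.le hα fun j => g j ω
  refine ⟨SWIPT.exists_isSDR1Optimal p _ hne, fun X hX => ?_⟩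
  obtain ⟨w, rfl⟩ := hX.exists_eq_toCovariances hP hσ hγ hG hgen hO
  refine ⟨fun i => SWIPT.rank_outer (SWIPT.ne_zero_of_mem_sdr1Feasible hσ hX.1 i), ?_, w,
    fun _ => rfl, SWIPT.isP1Optimal_of_isSDR1Optimal_toCovariances hσ hγ hX,
    (SWIPT.sdr1Objective_toCovariances _ _ _).symm⟩
  rw [SWIPT.toCovariances_zero_right]
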